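/- Let $W, B^1, B^2, \dots$ be independent standard one-dimensional Brownian motions on a probability space $(\Omega,\mathcal F,\mathbf P)$ and let $\hat\alpha,\hat\beta,a,\delta,S,T>0$ be real numbers. Then $$ \lim_{n\to\infty}\mathbf P\Big(\bigcup_{i=1}^n\Big(\Big\{\sup_{0\le t\le S}\big(\hat\beta B^i_t+\hat\alpha W_t\big)\ge a\Big\}\cap\Big\{\inf_{0\le t\le T}\big(\hat\beta B^i_t+\hat\alpha W_t\big)\ge-\delta\Big\}\Big)\Big)=1 . $$ -/

import Mathlib

open MeasureTheory ProbabilityTheory Filter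
open scoped NNReal ENNReal Topology

/-! Put R = max(S, T) and let ν be the law of Brownian motion on C([0, R]). Almost surely the
independent paths B^i come arbitrarily close to every point of the support of ν, simultaneously, so
the point approximated may depend on ω. The path w of W lies in that support. If k·t − (α/β)w does
too, then some B^i is within δ/β of it, so βB^i + αW exceeds βk·t − δ on [0, R]; with βk = (a + δ)/S
this is at least −δ everywhere and at least a at time S.

The support is handled without Cameron–Martin. A rotation cX + sY (c² + s² = 1) of independent
Brownian motions is Brownian, so the support is stable under rotations, hence a linear subspace.
Giving the bridge of X the endpoint of Y also yields a Brownian motion; applied to the zero path and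
a path with nonzero endpoint, this puts a nonzero linear path in the support. -/

section Support

/-! ### Supports of laws and independent samples. -/

variable {Ω E : Type*} [MeasurableSpace Ω] {P : Measure Ω} [MeasurableSpace E]

/-- An independent sequence with common law `ν` almost surely visits every set of positive
`ν`-measure. -/
lemma ae_exists_mem_of_iIndepFun {Y : ℕ → Ω → E} {ν : Measure E} [IsProbabilityMeasure P]
    (hY : ∀ i, AEMeasurable (Y i) P) (hν : ∀ i, P.map (Y i) = ν) (hind : iIndepFun Y P)
    {U : Set E} (hU : MeasurableSet U) (hpos : 0 < ν U) : ∀ᵐ ω ∂P, ∃ i, Y i ω ∈ U := by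
  have hprob : IsProbabilityMeasure ν := hν 0 ▸ Measure.isProbabilityMeasure_map (hY 0)
  have hlt : ν Uᶜ < 1 := by
    rw [prob_compl_eq_one_sub hU]
    exact ENNReal.sub_lt_self ENNReal.one_ne_top one_ne_zero hpos.ne'
  have hle (n : ℕ) : P {ω | ¬ ∃ i, Y i ω ∈ U} ≤ ν Uᶜ ^ n := by
    calc P {ω | ¬ ∃ i, Y i ω ∈ U} ≤ P (⋂ i ∈ Finset.range n, Y i ⁻¹' Uᶜ) := by
          refine measure_mono fun ω hω => ?_
          simp only [Set.mem_iInter, Set.mem_preimage, Set.mem_compl_iff]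
          exact fun i _ hi => hω ⟨i, hi⟩
      _ = ∏ i ∈ Finset.range n, P (Y i ⁻¹' Uᶜ) :=
          hind.measure_inter_preimage_eq_mul (sets := fun _ => Uᶜ) _ fun _ _ => hU.compl
      _ = ν Uᶜ ^ n := by
          rw [Finset.prod_congr rfl fun i _ => ?_, Finset.prod_const, Finset.card_range]
          rw [← hν i, Measure.map_apply_of_aemeasurable (hY i) hU.compl]
  exact le_antisymm (ge_of_tendsto' (ENNReal.tendsto_pow_atTop_nhds_zero_of_lt_one hlt) hle) zero_le

variable [TopologicalSpace E] [OpensMeasurableSpace E]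

/-- An independent sequence with common law `ν` is almost surely dense in the support of `ν`. -/
lemma ae_forall_mem_support_exists_mem [SecondCountableTopology E] {Y : ℕ → Ω → E} {ν : Measure E}
    [IsProbabilityMeasure P] (hY : ∀ i, AEMeasurable (Y i) P) (hν : ∀ i, P.map (Y i) = ν)
    (hind : iIndepFun Y P) :
    ∀ᵐ ω ∂P, ∀ x ∈ ν.support, ∀ U ∈ 𝓝 x, ∃ i, Y i ω ∈ U := by
  have h : ∀ᵐ ω ∂P, ∀ U ∈ TopologicalSpace.countableBasis E, 0 < ν U → ∃ i, Y i ω ∈ U := by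
    rw [ae_ball_iff (TopologicalSpace.countable_countableBasis E)]
    intro U hU
    by_cases hpos : 0 < ν U
    · filter_upwards [ae_exists_mem_of_iIndepFun hY hν hind
        (TopologicalSpace.isOpen_of_mem_countableBasis hU).measurableSet hpos] with ω hω _ using hω
    · exact .of_forall fun ω h => absurd h hpos
  filter_upwards [h] with ω hω x hx U hU
  obtain ⟨V, hV, hxV, hVU⟩ :=
    (TopologicalSpace.isBasis_countableBasis E).mem_nhds_iff.1 hU
  obtain ⟨i, hi⟩ := hω V hV ((Measure.mem_support_iff_forall x).1 hx V
    ((TopologicalSpace.isOpen_of_mem_countableBasis hV).mem_nhds hxV))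
  exact ⟨i, hVU hi⟩

/-- If `T X Y` has the same law `ν` as the independent variables `X` and `Y`, then the support of
`ν` is stable under `T`. -/
lemma apply_mem_support_of_indepFun {X Y Z : Ω → E} {ν : Measure E} {T : E → E → E}
    (hX : AEMeasurable X P) (hY : AEMeasurable Y P) (hZ : AEMeasurable Z P)
    (hXν : P.map X = ν) (hYν : P.map Y = ν) (hZν : P.map Z = ν) (hind : X ⟂ᵢ[P] Y)
    (hT : Continuous fun p : E × E => T p.1 p.2) (hZT : ∀ᵐ ω ∂P, Z ω = T (X ω) (Y ω))
    {x y : E} (hx : x ∈ ν.support) (hy : y ∈ ν.support) : T x y ∈ ν.support := by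
  rw [Measure.support_eq_forall_isOpen]
  intro U hTU hU
  obtain ⟨V₁, V₂, hV₁, hV₂, hxV, hyV, hV⟩ := isOpen_prod_iff.1 (hU.preimage hT) x y hTU
  have h₁ : 0 < P (X ⁻¹' V₁) := by
    rw [← Measure.map_apply_of_aemeasurable hX hV₁.measurableSet, hXν]
    exact (Measure.mem_support_iff_forall x).1 hx _ (hV₁.mem_nhds hxV)
  have h₂ : 0 < P (Y ⁻¹' V₂) := by
    rw [← Measure.map_apply_of_aemeasurable hY hV₂.measurableSet, hYν]
    exact (Measure.mem_support_iff_forall y).1 hy _ (hV₂.mem_nhds hyV)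
  calc 0 < P (X ⁻¹' V₁) * P (Y ⁻¹' V₂) := ENNReal.mul_pos h₁.ne' h₂.ne'
    _ = P (X ⁻¹' V₁ ∩ Y ⁻¹' V₂) :=
        (hind.measure_inter_preimage_eq_mul _ _ hV₁.measurableSet hV₂.measurableSet).symm
    _ ≤ P (Z ⁻¹' U) := by
        refine measure_mono_ae ?_
        filter_upwards [hZT] with ω hω h
        change Z ω ∈ U
        rw [hω]
        exact hV (Set.mk_mem_prod h.1 h.2)
    _ = ν U := by rw [← hZν, Measure.map_apply_of_aemeasurable hZ hU.measurableSet]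

end Support

/-! ### Rotation-stable sets are linear subspaces. -/

section Rotation

variable {E : Type*} [AddCommGroup E] [Module ℝ E] {K : Set E}

/-- A nonempty set stable under all rotations `(x, y) ↦ c • x + s • y` contains the origin. -/
lemma zero_mem_of_rotation (hK : ∀ c s : ℝ, c ^ 2 + s ^ 2 = 1 → ∀ x ∈ K, ∀ y ∈ K, c • x + s • y ∈ K)
    {x : E} (hx : x ∈ K) : (0 : E) ∈ K := by
  have h2 : (√2)⁻¹ ^ 2 + (-(√2)⁻¹) ^ 2 = (1 : ℝ) := by
    rw [neg_sq, inv_pow, Real.sq_sqrt two_pos.le]; norm_num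
  simpa using hK _ _ h2 x hx x hx

/-- Rotating the pair (x, x) by 45° gives √2 • x, so arbitrarily large multiples are reached;
rotating such a multiple against 0 then shrinks it to any smaller one, of either sign. -/
lemma smul_mem_of_rotation (hK : ∀ c s : ℝ, c ^ 2 + s ^ 2 = 1 → ∀ x ∈ K, ∀ y ∈ K, c • x + s • y ∈ K)
    {x : E} (hx : x ∈ K) (k : ℝ) : k • x ∈ K := by
  have h2 : (√2)⁻¹ ^ 2 + (√2)⁻¹ ^ 2 = (1 : ℝ) := by
    rw [inv_pow, Real.sq_sqrt two_pos.le]; norm_num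
  have hs : (√2)⁻¹ + (√2)⁻¹ = √2 := by
    field_simp
    norm_num
  have hpow (n : ℕ) : (√2 ^ n) • x ∈ K := by
    induction n with
    | zero => simpa using hx
    | succ n ih =>
      have := hK _ _ h2 _ ih _ ih
      rwa [← add_smul, hs, smul_smul, ← pow_succ'] at this
  have h1 : (1 : ℝ) < √2 := by rw [Real.lt_sqrt zero_le_one]; norm_num
  obtain ⟨n, hn⟩ := pow_unbounded_of_one_lt |k| h1
  have hp : 0 < √2 ^ n := by positivity
  have hc : (k / √2 ^ n) ^ 2 ≤ 1 := by
    rw [sq_le_one_iff_abs_le_one, abs_div, abs_of_pos hp, div_le_one hp]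
    exact hn.le
  have := hK (k / √2 ^ n) (√(1 - (k / √2 ^ n) ^ 2)) (by rw [Real.sq_sqrt (by linarith)]; ring)
    _ (hpow n) _ (zero_mem_of_rotation hK hx)
  rwa [smul_zero, add_zero, smul_smul, div_mul_cancel₀ _ hp.ne'] at this

lemma add_mem_of_rotation (hK : ∀ c s : ℝ, c ^ 2 + s ^ 2 = 1 → ∀ x ∈ K, ∀ y ∈ K, c • x + s • y ∈ K)
    {x y : E} (hx : x ∈ K) (hy : y ∈ K) : x + y ∈ K := by
  have h2 : (√2)⁻¹ ^ 2 + (√2)⁻¹ ^ 2 = (1 : ℝ) := by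
    rw [inv_pow, Real.sq_sqrt two_pos.le]; norm_num
  have := smul_mem_of_rotation hK (hK _ _ h2 x hx y hy) √2
  rwa [← smul_add, smul_smul, mul_inv_cancel₀ (by positivity), one_smul] at this

end Rotation

/-! ### Brownian motions built from an independent pair. -/

section GaussianPair

variable {Ω S T : Type*} [MeasurableSpace Ω] {P : Measure Ω} {X : S → Ω → ℝ} {Y : T → Ω → ℝ}

/-- Two independent Gaussian processes are jointly Gaussian. -/
lemma ProbabilityTheory.IsGaussianProcess.sumElim (hX : IsGaussianProcess X P)
    (hY : IsGaussianProcess Y P) (hind : (fun ω s => X s ω) ⟂ᵢ[P] (fun ω t => Y t ω)) :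
    IsGaussianProcess (Sum.elim X Y) P where
  hasGaussianLaw I := by
    classical
    have h : (fun ω => I.toLeft.restrict (X · ω)) ⟂ᵢ[P] (fun ω => I.toRight.restrict (Y · ω)) :=
      hind.comp (Finset.measurable_restrict _) (Finset.measurable_restrict _)
    let L : ((I.toLeft → ℝ) × (I.toRight → ℝ)) →L[ℝ] (I → ℝ) := LinearMap.toContinuousLinearMap
      { toFun p i := match i with
          | ⟨.inl s, hs⟩ => p.1 ⟨s, by simpa using hs⟩
          | ⟨.inr t, ht⟩ => p.2 ⟨t, by simpa using ht⟩
        map_add' p q := by ext ⟨s | t, h⟩ <;> rfl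
        map_smul' c p := by ext ⟨s | t, h⟩ <;> rfl }
    have hL : (fun ω => I.restrict (Sum.elim X Y · ω)) =
        L ∘ fun ω => (I.toLeft.restrict (X · ω), I.toRight.restrict (Y · ω)) := by
      ext ω ⟨s | t, h⟩ <;> rfl
    rw [hL]
    exact (h.hasGaussianLaw (hX.hasGaussianLaw _) (hY.hasGaussianLaw _)).map L

end GaussianPair

namespace ProbabilityTheory.IsBrownianReal

variable {Ω : Type*} [MeasurableSpace Ω] {P : Measure Ω} {X Y : ℝ≥0 → Ω → ℝ}

lemma memLp_two (hX : IsBrownianReal X P) (t : ℝ≥0) : MemLp (X t) 2 P :=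
  (hX.isGaussianProcess.hasGaussianLaw_eval t).memLp_two

lemma covariance_eq_zero_of_indepFun (hX : IsBrownianReal X P) (hY : IsBrownianReal Y P)
    (hind : (fun ω t => X t ω) ⟂ᵢ[P] (fun ω t => Y t ω)) (s t : ℝ≥0) : cov[X s, Y t; P] = 0 :=
  (hind.comp (measurable_pi_apply s) (measurable_pi_apply t)).covariance_eq_zero
    (hX.memLp_two s) (hY.memLp_two t)

/-- A rotation of two independent Brownian motions is a Brownian motion. -/
lemma rotation (hX : IsBrownianReal X P) (hY : IsBrownianReal Y P)
    (hind : (fun ω t => X t ω) ⟂ᵢ[P] (fun ω t => Y t ω)) {c s : ℝ} (hcs : c ^ 2 + s ^ 2 = 1) :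
    IsBrownianReal (fun t => c • X t + s • Y t) P where
  toIsPreBrownianReal := by
    have := hX.isGaussianProcess.isProbabilityMeasure
    classical
    have hXY := hX.isGaussianProcess.sumElim hY.isGaussianProcess hind
    refine IsGaussianProcess.isPreBrownianReal_of_covariance
      (IsGaussianProcess.of_isGaussianProcess hXY fun t =>
        ⟨{.inl t, .inr t},
        { toFun x := c * x ⟨.inl t, by simp⟩ + s * x ⟨.inr t, by simp⟩
          map_add' x y := by simp; ring
          map_smul' c x := by simp; ring }, fun ω => by simp⟩) (fun t => ?_) fun u t hut => ?_
    · simp only [Pi.add_apply, Pi.smul_apply, smul_eq_mul]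
      rw [integral_add ((hX.integrable_eval t).const_mul c) ((hY.integrable_eval t).const_mul s),
        integral_const_mul, integral_const_mul, hX.integral_eval, hY.integral_eval]
      simp
    · have h1 (v : ℝ≥0) : MemLp (c • X v) 2 P := (hX.memLp_two v).const_smul c
      have h2 (v : ℝ≥0) : MemLp (s • Y v) 2 P := (hY.memLp_two v).const_smul s
      rw [covariance_add_left (h1 u) (h2 u) ((h1 t).add (h2 t)),
        covariance_add_right (h1 u) (h1 t) (h2 t), covariance_add_right (h2 u) (h1 t) (h2 t)]
      simp only [covariance_smul_left, covariance_smul_right]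
      rw [hX.covariance_eval, hY.covariance_eval, hX.covariance_eq_zero_of_indepFun hY hind,
        covariance_comm (Y u), hX.covariance_eq_zero_of_indepFun hY hind, min_eq_left hut]
      linear_combination (u : ℝ) * hcs
  cont := by
    filter_upwards [hX.cont, hY.cont] with ω h1 h2
    exact (h1.const_smul c).add (h2.const_smul s)

/-- Replacing the endpoint at time `R` of the Brownian motion `X` by that of an independent
Brownian motion `Y`, while keeping the bridge of `X`, yields a Brownian motion. -/
lemma replace_endpoint (hX : IsBrownianReal X P) (hY : IsBrownianReal Y P)
    (hind : (fun ω t => X t ω) ⟂ᵢ[P] (fun ω t => Y t ω)) {R : ℝ≥0} (hR : 0 < R) :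
    IsBrownianReal (fun t => X t + ((min t R : ℝ≥0) / R : ℝ) • (Y R - X R)) P where
  toIsPreBrownianReal := by
    have := hX.isGaussianProcess.isProbabilityMeasure
    classical
    have hXY := hX.isGaussianProcess.sumElim hY.isGaussianProcess hind
    refine IsGaussianProcess.isPreBrownianReal_of_covariance
      (IsGaussianProcess.of_isGaussianProcess hXY fun t =>
        ⟨{.inl t, .inl R, .inr R},
        { toFun x := x ⟨.inl t, by simp⟩ +
            ((min t R : ℝ≥0) / R : ℝ) * (x ⟨.inr R, by simp⟩ - x ⟨.inl R, by simp⟩)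
          map_add' x y := by simp only [Pi.add_apply]; ring
          map_smul' c x := by simp only [Pi.smul_apply, smul_eq_mul, RingHom.id_apply]; ring },
        fun ω => by simp⟩) (fun t => ?_) fun u t hut => ?_
    · simp only [Pi.add_apply, Pi.smul_apply, Pi.sub_apply, smul_eq_mul]
      have hi : Integrable (fun ω => Y R ω - X R ω) P :=
        (hY.integrable_eval R).sub (hX.integrable_eval R)
      rw [integral_add (hX.integrable_eval t) (hi.const_mul _),
        integral_const_mul, integral_sub (hY.integrable_eval R) (hX.integrable_eval R),
        hX.integral_eval, hX.integral_eval, hY.integral_eval]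
      simp
    · have hd : MemLp (Y R - X R) 2 P := (hY.memLp_two R).sub (hX.memLp_two R)
      have hc (r : ℝ) : MemLp (r • (Y R - X R)) 2 P := hd.const_smul r
      rw [covariance_add_left (hX.memLp_two u) (hc _) ((hX.memLp_two t).add (hc _)),
        covariance_add_right (hX.memLp_two u) (hX.memLp_two t) (hc _),
        covariance_add_right (hc _) (hX.memLp_two t) (hc _)]
      simp only [covariance_smul_left, covariance_smul_right]
      rw [covariance_sub_right (hX.memLp_two u) (hY.memLp_two R) (hX.memLp_two R),
        covariance_sub_left (hY.memLp_two R) (hX.memLp_two R) (hX.memLp_two t),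
        covariance_sub_left (hY.memLp_two R) (hX.memLp_two R) hd,
        covariance_sub_right (hX.memLp_two R) (hY.memLp_two R) (hX.memLp_two R),
        covariance_sub_right (hY.memLp_two R) (hY.memLp_two R) (hX.memLp_two R),
        covariance_comm (Y R) (X t), covariance_comm (Y R) (X R)]
      simp only [hX.covariance_eval, hY.covariance_eval,
        hX.covariance_eq_zero_of_indepFun hY hind, min_eq_left hut, min_self, min_comm R t]
      -- With m_v = min(v, R), the cross terms contribute −2 m_u m_t / R and the endpoint term 2R ·
      -- m_u m_t / R². They cancel, leaving u.
      have : (R : ℝ) ≠ 0 := by exact_mod_cast hR.ne'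
      field_simp
      ring
  cont := by
    filter_upwards [hX.cont] with ω h
    simp only [Pi.add_apply, Pi.smul_apply]
    fun_prop

end ProbabilityTheory.IsBrownianReal

/-! ### Brownian paths as random elements of C([0, R]). -/

section EvalDenseSeq

open TopologicalSpace

variable {K : Type*} [TopologicalSpace K] [CompactSpace K] [SecondCountableTopology K] [T2Space K]
  [Nonempty K] [MeasurableSpace C(K, ℝ)] [BorelSpace C(K, ℝ)]

/-- Continuous functions are measurably determined by their values along a dense sequence. -/
lemma measurableEmbedding_eval_denseSeq :
    MeasurableEmbedding fun (f : C(K, ℝ)) (n : ℕ) => f (denseSeq K n) := by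
  refine Continuous.measurableEmbedding (by fun_prop) fun f g hfg => ?_
  refine DFunLike.coe_injective (f.continuous.ext_on (denseRange_denseSeq K) g.continuous ?_)
  rintro _ ⟨n, rfl⟩
  exact congrFun hfg n

end EvalDenseSeq

section ContPath

variable {Ω : Type*} [MeasurableSpace Ω] {P : Measure Ω} {X Y : ℝ≥0 → Ω → ℝ} {R : ℝ≥0}

open Classical in
/-- The path of a process on `[0, R]` as a continuous function (zero if the path is not
continuous). -/
noncomputable def contPath (R : ℝ≥0) (X : ℝ≥0 → Ω → ℝ) (ω : Ω) : C(Set.Icc 0 R, ℝ) :=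
  if h : Continuous (X · ω) then ⟨fun t => X t ω, h.comp continuous_subtype_val⟩ else 0

omit [MeasurableSpace Ω] in
lemma contPath_apply {ω : Ω} (h : Continuous (X · ω)) (t : Set.Icc 0 R) :
    contPath R X ω t = X t ω := by
  simp [contPath, h]

instance : Nonempty (Set.Icc 0 R) := ⟨⟨0, by simp⟩⟩

/-- The time `R` as an element of `[0, R]`. -/
def endTime (R : ℝ≥0) : Set.Icc 0 R := ⟨R, Set.right_mem_Icc.2 zero_le⟩

/-- The linear path `t ↦ t` on `[0, R]`. -/
def linearPath (R : ℝ≥0) : C(Set.Icc 0 R, ℝ) := ⟨fun t => ((t : ℝ≥0) : ℝ), by fun_prop⟩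

/-- The path with the endpoint of `y` obtained from `x` by adding a linear path. -/
noncomputable def replaceEndpoint (x y : C(Set.Icc 0 R, ℝ)) : C(Set.Icc 0 R, ℝ) :=
  x + ((y (endTime R) - x (endTime R)) / (R : ℝ)) • linearPath R

lemma continuous_replaceEndpoint :
    Continuous fun p : C(Set.Icc 0 R, ℝ) × C(Set.Icc 0 R, ℝ) => replaceEndpoint p.1 p.2 := by
  unfold replaceEndpoint
  fun_prop

/-- A dense sequence of times in `[0, R]`. -/
noncomputable def denseTime (R : ℝ≥0) (n : ℕ) : ℝ≥0 := TopologicalSpace.denseSeq (Set.Icc 0 R) n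

namespace ProbabilityTheory.IsBrownianReal

lemma contPath_denseTime_ae_eq (hX : IsBrownianReal X P) :
    (fun ω n => contPath R X ω (TopologicalSpace.denseSeq (Set.Icc 0 R) n)) =ᵐ[P]
      fun ω n => X (denseTime R n) ω := by
  filter_upwards [hX.cont] with ω h
  ext n
  exact contPath_apply h _

lemma aemeasurable_denseTime (hX : IsBrownianReal X P) :
    AEMeasurable (fun ω n => X (denseTime R n) ω) P :=
  aemeasurable_pi_lambda _ fun _ => hX.aemeasurable _

lemma map_denseTime_eq (hX : IsBrownianReal X P) (hY : IsBrownianReal Y P) :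
    P.map (fun ω n => X (denseTime R n) ω) = P.map (fun ω n => Y (denseTime R n) ω) := by
  have := hX.isGaussianProcess.isProbabilityMeasure
  classical
  refine (map_eq_iff_forall_finset_map_restrict_eq (X := fun n => X (denseTime R n))
    (Y := fun n => Y (denseTime R n)) hX.aemeasurable_denseTime hY.aemeasurable_denseTime).2
    fun J => ?_
  -- The times `denseTime R n` may repeat, so the marginal over the indices in J is pulled back from
  -- the finite set of distinct times.
  let φ : (J.image (denseTime R) → ℝ) → J → ℝ :=
    fun x j => x ⟨denseTime R j, Finset.mem_image_of_mem _ j.2⟩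
  have hφ : Measurable φ := measurable_pi_lambda _ fun _ => measurable_pi_apply _
  have key {Z : ℝ≥0 → Ω → ℝ} (hZ : IsBrownianReal Z P) :
      P.map (fun ω => J.restrict fun n => Z (denseTime R n) ω) =
        (BrownianReal.projectiveFamily (J.image (denseTime R))).map φ := by
    rw [← (hZ.hasLaw (J.image (denseTime R))).map_eq,
      AEMeasurable.map_map_of_aemeasurable hφ.aemeasurable (hZ.hasLaw _).aemeasurable]
    rfl
  rw [key hX, key hY]

lemma ae_ne_zero (hX : IsBrownianReal X P) (hR : 0 < R) : ∀ᵐ ω ∂P, X R ω ≠ 0 := by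
  have : NullSingletonClass (gaussianReal 0 R) := nullSingletonClass_gaussianReal hR.ne'
  refine ae_of_ae_map (hX.aemeasurable R) (p := fun z => z ≠ 0) ?_
  rw [(hX.hasLaw_eval R).map_eq]
  exact Measure.ae_ne _ 0

variable [MeasurableSpace C(Set.Icc 0 R, ℝ)] [BorelSpace C(Set.Icc 0 R, ℝ)]

lemma aemeasurable_contPath (hX : IsBrownianReal X P) : AEMeasurable (contPath R X) P :=
  measurableEmbedding_eval_denseSeq.aemeasurable_comp_iff.1
    (hX.aemeasurable_denseTime.congr hX.contPath_denseTime_ae_eq.symm)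

lemma map_contPath_eq (hX : IsBrownianReal X P) (hY : IsBrownianReal Y P) :
    P.map (contPath R X) = P.map (contPath R Y) := by
  have hρ := measurableEmbedding_eval_denseSeq (K := Set.Icc 0 R)
  have key {Z : ℝ≥0 → Ω → ℝ} (hZ : IsBrownianReal Z P) :
      P.map (contPath R Z) = (P.map fun ω n => Z (denseTime R n) ω).comap
        fun (f : C(Set.Icc 0 R, ℝ)) n => f (TopologicalSpace.denseSeq (Set.Icc 0 R) n) := by
    rw [← hρ.comap_map (P.map (contPath R Z)),
      AEMeasurable.map_map_of_aemeasurable hρ.measurable.aemeasurable hZ.aemeasurable_contPath]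
    exact congrArg _ (Measure.map_congr hZ.contPath_denseTime_ae_eq)
  rw [key hX, key hY, hX.map_denseTime_eq hY]

/-- Independence is given for the product σ-algebra, where continuity of a path is not a measurable
event; it is therefore passed through the values at countably many times, which determine the path
measurably. -/
lemma iIndepFun_contPath {ι : Type*} {B : ι → ℝ≥0 → Ω → ℝ} (hB : ∀ i, IsBrownianReal (B i) P)
    (hind : iIndepFun (fun i ω t => B i t ω) P) : iIndepFun (fun i => contPath R (B i)) P := by
  have hρ := measurableEmbedding_eval_denseSeq (K := Set.Icc 0 R)
  have h : iIndepFun (fun i ω n => contPath R (B i) ω (TopologicalSpace.denseSeq _ n)) P :=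
    (iIndepFun_congr fun i => (hB i).contPath_denseTime_ae_eq).2
      (hind.comp (fun _ x n => x (denseTime R n))
        fun _ => measurable_pi_lambda _ fun _ => measurable_pi_apply _)
  have := h.comp (fun _ => hρ.invFun) fun _ => hρ.measurable_invFun
  convert this using 2 with i
  exact funext fun ω => (hρ.leftInverse_invFun _).symm

lemma ae_contPath_mem_support (hX : IsBrownianReal X P) :
    ∀ᵐ ω ∂P, contPath R X ω ∈ (P.map (contPath R X)).support :=
  ae_of_ae_map hX.aemeasurable_contPath Measure.support_mem_ae

lemma rotation_mem_support (hX : IsBrownianReal X P) (hY : IsBrownianReal Y P)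
    (hXY : (fun ω t => X t ω) ⟂ᵢ[P] (fun ω t => Y t ω)) (hind : contPath R X ⟂ᵢ[P] contPath R Y)
    {c s : ℝ} (hcs : c ^ 2 + s ^ 2 = 1) {x y : C(Set.Icc 0 R, ℝ)}
    (hx : x ∈ (P.map (contPath R X)).support) (hy : y ∈ (P.map (contPath R X)).support) :
    c • x + s • y ∈ (P.map (contPath R X)).support := by
  have hZ := hX.rotation hY hXY hcs
  refine apply_mem_support_of_indepFun (T := fun x y => c • x + s • y) hX.aemeasurable_contPath
    hY.aemeasurable_contPath hZ.aemeasurable_contPath rfl (hY.map_contPath_eq hX)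
    (hZ.map_contPath_eq hX) hind (by fun_prop) ?_ hx hy
  filter_upwards [hX.cont, hY.cont, hZ.cont] with ω h1 h2 h3
  ext t
  rw [contPath_apply h3]
  simp [contPath_apply h1, contPath_apply h2]

lemma replaceEndpoint_mem_support (hX : IsBrownianReal X P) (hY : IsBrownianReal Y P)
    (hXY : (fun ω t => X t ω) ⟂ᵢ[P] (fun ω t => Y t ω)) (hind : contPath R X ⟂ᵢ[P] contPath R Y)
    (hR : 0 < R) {x y : C(Set.Icc 0 R, ℝ)}
    (hx : x ∈ (P.map (contPath R X)).support) (hy : y ∈ (P.map (contPath R X)).support) :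
    replaceEndpoint x y ∈ (P.map (contPath R X)).support := by
  have hZ := hX.replace_endpoint hY hXY hR
  refine apply_mem_support_of_indepFun
    hX.aemeasurable_contPath hY.aemeasurable_contPath hZ.aemeasurable_contPath rfl
    (hY.map_contPath_eq hX) (hZ.map_contPath_eq hX) hind continuous_replaceEndpoint ?_ hx hy
  filter_upwards [hX.cont, hY.cont, hZ.cont] with ω h1 h2 h3
  ext t
  rw [contPath_apply h3]
  simp only [Pi.add_apply, Pi.smul_apply, Pi.sub_apply, smul_eq_mul, ContinuousMap.add_apply,
    ContinuousMap.smul_apply, contPath_apply h1, contPath_apply h2, linearPath, replaceEndpoint,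
    endTime, ContinuousMap.coe_mk, min_eq_left t.2.2]
  ring

/-- The support of the law of Brownian motion on `[0, R]` contains every combination of a point of
the support and a linear path. -/
lemma smul_linearPath_add_smul_mem_support [IsProbabilityMeasure P] (hX : IsBrownianReal X P)
    (hY : IsBrownianReal Y P) (hXY : (fun ω t => X t ω) ⟂ᵢ[P] (fun ω t => Y t ω))
    (hind : contPath R X ⟂ᵢ[P] contPath R Y) (hR : 0 < R) {x : C(Set.Icc 0 R, ℝ)}
    (hx : x ∈ (P.map (contPath R X)).support) (k r : ℝ) :
    k • linearPath R + r • x ∈ (P.map (contPath R X)).support := by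
  have hrot (c s : ℝ) (hcs : c ^ 2 + s ^ 2 = 1) (x) (hx : x ∈ (P.map (contPath R X)).support)
      (y) (hy : y ∈ (P.map (contPath R X)).support) :
      c • x + s • y ∈ (P.map (contPath R X)).support :=
    hX.rotation_mem_support hY hXY hind hcs hx hy
  obtain ⟨ω, h1, h2, h3⟩ :=
    ((hX.ae_contPath_mem_support (R := R)).and ((hX.ae_ne_zero hR).and hX.cont)).exists
  -- The zero path with its endpoint replaced by X R ω is the line of slope X R ω / R, which is
  -- nonzero and can be rescaled to slope k.
  have hline := hX.replaceEndpoint_mem_support hY hXY hind hR (zero_mem_of_rotation hrot hx) h1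
  rw [replaceEndpoint, zero_add, ContinuousMap.zero_apply, sub_zero, contPath_apply h3, endTime] at hline
  have hq : X R ω / R ≠ 0 := div_ne_zero h2 (by exact_mod_cast hR.ne')
  have := smul_mem_of_rotation hrot hline (k / (X R ω / R))
  rw [smul_smul, div_mul_cancel₀ _ hq] at this
  exact add_mem_of_rotation hrot this (smul_mem_of_rotation hrot hx r)

end ProbabilityTheory.IsBrownianReal

end ContPath

/-- `B i` (for `i : ℕ`) is the process usually written `B^{i+1}`, so the union over `i < n` is the
union over the first `n` processes. The supremum and the infimum of the path are taken in the
extended reals, so that they are the genuine ones for every `ω`. -/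
theorem mainTheorem5 {Ω : Type*} [MeasurableSpace Ω] (P : Measure Ω) [IsProbabilityMeasure P]
    (W : ℝ≥0 → Ω → ℝ) (B : ℕ → ℝ≥0 → Ω → ℝ)
    (hW : IsBrownianReal W P) (hB : ∀ i, IsBrownianReal (B i) P)
    (hindep : iIndepFun (fun (j : Option ℕ) (ω : Ω) (t : ℝ≥0) => (j.elim W B) t ω) P)
    (α β a δ : ℝ) (S T : ℝ≥0)
    (hα : 0 < α) (hβ : 0 < β) (ha : 0 < a) (hδ : 0 < δ) (hS : 0 < S) (hT : 0 < T) :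
    Tendsto
      (fun n : ℕ => P (⋃ i ∈ Finset.range n,
        ({ω | (a : EReal) ≤ ⨆ t ∈ Set.Icc 0 S, ((β * B i t ω + α * W t ω : ℝ) : EReal)} ∩
          {ω | ((-δ : ℝ) : EReal) ≤
            ⨅ t ∈ Set.Icc 0 T, ((β * B i t ω + α * W t ω : ℝ) : EReal)})))
      atTop (𝓝 1) := by
  set A : ℕ → Set Ω := fun i =>
    {ω | (a : EReal) ≤ ⨆ t ∈ Set.Icc 0 S, ((β * B i t ω + α * W t ω : ℝ) : EReal)} ∩
      {ω | ((-δ : ℝ) : EReal) ≤ ⨅ t ∈ Set.Icc 0 T, ((β * B i t ω + α * W t ω : ℝ) : EReal)}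
  set R : ℝ≥0 := max S T
  have hR : 0 < R := lt_max_of_lt_left hS
  borelize C(Set.Icc 0 R, ℝ)
  have hBind : iIndepFun (fun i ω t => B i t ω) P := hindep.precomp (Option.some_injective ℕ)
  have hpath := IsBrownianReal.iIndepFun_contPath (R := R) hB hBind
  set ν := P.map (contPath R (B 0)) with hν
  have hdense := ae_forall_mem_support_exists_mem (fun i => (hB i).aemeasurable_contPath)
    (fun i => (hB i).map_contPath_eq (hB 0)) hpath
  have hWsupp : ∀ᵐ ω ∂P, contPath R W ω ∈ ν.support := by
    rw [hν, ← hW.map_contPath_eq (hB 0)]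
    exact hW.ae_contPath_mem_support
  have hA : ∀ᵐ ω ∂P, ω ∈ ⋃ i, A i := by
    filter_upwards [hdense, hWsupp, hW.cont, ae_all_iff.2 fun i => (hB i).cont]
      with ω hd hs hWc hBc
    -- After multiplication by β, the term −(α/β)w cancels αW, and the slope becomes (a + δ)/S: the
    -- line reaches a + δ at time S, leaving room for an error δ.
    have hmem := (hB 0).smul_linearPath_add_smul_mem_support (hB 1)
      (hBind.indepFun zero_ne_one) (hpath.indepFun zero_ne_one) hR hs
      ((a + δ) / (β * S)) (-(α / β))
    obtain ⟨i, hi⟩ := hd _ hmem _ (Metric.ball_mem_nhds _ (div_pos hδ hβ))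
    have hS' : (0 : ℝ) < S := by exact_mod_cast hS
    have hclose (t : ℝ≥0) (ht : t ≤ R) :
        (a + δ) * (t / S) - δ ≤ β * B i t ω + α * W t ω := by
      have h := (ContinuousMap.dist_apply_le_dist (f := contPath R (B i) ω)
        (g := ((a + δ) / (β * S)) • linearPath R + -(α / β) • contPath R W ω)
        ⟨t, zero_le, ht⟩).trans_lt hi
      rw [Real.dist_eq, contPath_apply (hBc i)] at h
      simp only [ContinuousMap.add_apply, ContinuousMap.smul_apply, contPath_apply hWc, linearPath,
        ContinuousMap.coe_mk, smul_eq_mul] at h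
      have h' := mul_lt_mul_of_pos_left (abs_lt.1 h).1 hβ
      have e1 : β * -(δ / β) = -δ := by field_simp
      have e2 : β * (B i t ω - ((a + δ) / (β * S) * t + -(α / β) * W t ω)) =
          β * B i t ω + α * W t ω - (a + δ) * (t / S) := by field_simp; ring
      rw [e1, e2] at h'
      linarith
    refine Set.mem_iUnion.2 ⟨i, ?_, ?_⟩
    · change (a : EReal) ≤ ⨆ t ∈ Set.Icc 0 S, ((β * B i t ω + α * W t ω : ℝ) : EReal)
      refine le_iSup₂_of_le S (Set.right_mem_Icc.2 zero_le) (EReal.coe_le_coe_iff.2 ?_)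
      simpa [hS'.ne'] using hclose S (le_max_left S T)
    · refine le_iInf₂ fun t ht => EReal.coe_le_coe_iff.2 ?_
      have h1 := hclose t (ht.2.trans (le_max_right S T))
      have h2 : 0 ≤ (a + δ) * ((t : ℝ) / S) := by positivity
      linarith
  have h1 : P (⋃ i, A i) = 1 := (measure_congr (eventuallyEq_univ.2 hA)).trans measure_univ
  have hunion : ⋃ n, ⋃ i ∈ Finset.range n, A i = ⋃ i, A i := by
    ext ω
    simp only [Set.mem_iUnion, Finset.mem_range, exists_prop]
    exact ⟨fun ⟨_, i, _, h⟩ => ⟨i, h⟩, fun ⟨i, h⟩ => ⟨i + 1, i, i.lt_succ_self, h⟩⟩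
  rw [← h1, ← hunion]
  refine tendsto_measure_iUnion_atTop fun m n hmn => ?_
  exact Set.biUnion_subset_biUnion_left (by simpa using hmn)
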